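/- Let $A$ be a real $n\times m$ matrix, let $\sigma_1(A)\ge\dots\ge\sigma_{\operatorname{rank}(A)}(A)>0$ be its nonzero singular values, and let $A^\dagger$ be its Moore-Penrose pseudo-inverse. For $S\subseteq\{1,\dots,m\}$ let $A_S$ be the submatrix of $A$ formed by the columns indexed by $S$, and let $\sigma_{\min}(B)=\min_{\|x\|_2=1}\|Bx\|_2$. Then for all integers $k,r$ with $1\le k\le r\le \operatorname{rank}(A)$ there exists a subset $S\subseteq\{1,\dots,m\}$ of size $k$ such that $$\sigma_{\min}(A_S)^2\ \ge\ \frac{(\sqrt r-\sqrt{k-1})^2}{m}\cdot\frac{r}{\sum_{i=1}^r\sigma_i(A)^{-2}}.$$ In particular, if $r=\operatorname{rank}(A)$, then $$\sigma_{\min}(A_S)^2\ \ge\ \frac{\bigl(\sqrt{\operatorname{rank}(A)}-\sqrt{k-1}\bigr)^2}{m}\cdot\frac{\operatorname{rank}(A)}{\|A^\dagger\|_F^2},$$ where $\|\cdot\|_F$ is the Frobenius norm. -/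

import Mathlib

open scoped Matrix Matrix.Norms.Frobenius

/-- `σ_min(B) = min_{‖x‖₂ = 1} ‖B x‖₂`, with Euclidean norms on both sides. The infimum is attained
as soon as `B` has at least one column, see `isLeast_sigmaMin`. -/
noncomputable def sigmaMin {n : ℕ} {ι : Type*} [Fintype ι] [DecidableEq ι]
    (B : Matrix (Fin n) ι ℝ) : ℝ :=
  sInf ((fun x : EuclideanSpace ℝ ι => ‖Matrix.toEuclideanLin B x‖) '' {x | ‖x‖ = 1})

theorem isLeast_sigmaMin {n : ℕ} {ι : Type*} [Fintype ι] [DecidableEq ι] [Nonempty ι]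
    (B : Matrix (Fin n) ι ℝ) :
    IsLeast ((fun x : EuclideanSpace ℝ ι => ‖Matrix.toEuclideanLin B x‖) '' {x | ‖x‖ = 1})
      (sigmaMin B) := by
  have hc : IsCompact {x : EuclideanSpace ℝ ι | ‖x‖ = 1} := by
    have h := isCompact_sphere (0 : EuclideanSpace ℝ ι) 1
    have e : Metric.sphere (0 : EuclideanSpace ℝ ι) 1 = {x | ‖x‖ = 1} := by
      ext x; simp
    rwa [e] at h
  have hne : ({x : EuclideanSpace ℝ ι | ‖x‖ = 1}).Nonempty := by
    obtain ⟨i⟩ := ‹Nonempty ι›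
    exact ⟨EuclideanSpace.single i 1, by simp⟩
  have hcont : Continuous (fun x : EuclideanSpace ℝ ι => ‖Matrix.toEuclideanLin B x‖) :=
    (LinearMap.continuous_of_finiteDimensional _).norm
  exact (hc.image hcont).isLeast_sInf (hne.image _)

/-- The submatrix `A_S` of the columns of `A` with index in `S`. -/
def columnSubmatrix {n m : ℕ} (A : Matrix (Fin n) (Fin m) ℝ) (S : Finset (Fin m)) :
    Matrix (Fin n) S ℝ :=
  A.submatrix id Subtype.val

/-- The nonincreasing sequence of singular values of `A`, indexed from `0`
(so the largest one is `sigma A 0`); the terms of index at least `A.rank` are zero. -/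
noncomputable def sigma {n m : ℕ} (A : Matrix (Fin n) (Fin m) ℝ) (i : ℕ) : ℝ :=
  (Matrix.toEuclideanLin A).singularValues i

/-- The four Penrose equations: `B` is the Moore-Penrose pseudo-inverse of the real matrix `A`. -/
structure IsMoorePenrose {n m : ℕ} (A : Matrix (Fin n) (Fin m) ℝ)
    (B : Matrix (Fin m) (Fin n) ℝ) : Prop where
  mul_mul_self : A * B * A = A
  self_mul_mul : B * A * B = B
  isSymm_left : (A * B).IsSymm
  isSymm_right : (B * A).IsSymm

theorem IsMoorePenrose.unique {n m : ℕ} {A : Matrix (Fin n) (Fin m) ℝ}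
    {B C : Matrix (Fin m) (Fin n) ℝ} (hB : IsMoorePenrose A B) (hC : IsMoorePenrose A C) :
    B = C := by
  have h1 : A * B = A * C := by
    calc A * B = (A * B)ᵀ := hB.isSymm_left.symm
      _ = ((A * C) * (A * B))ᵀ := by
          rw [← Matrix.mul_assoc (A * C) A B, hC.mul_mul_self]
      _ = (A * B) * (A * C) := by
          rw [Matrix.transpose_mul, hB.isSymm_left.eq, hC.isSymm_left.eq]
      _ = A * C := by rw [← Matrix.mul_assoc (A * B) A C, hB.mul_mul_self]
  have h2 : B * A = C * A := by
    calc B * A = (B * A)ᵀ := hB.isSymm_right.symm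
      _ = ((B * A) * (C * A))ᵀ := by
          rw [Matrix.mul_assoc B A (C * A), ← Matrix.mul_assoc A C A, hC.mul_mul_self]
      _ = (C * A) * (B * A) := by
          rw [Matrix.transpose_mul, hB.isSymm_right.eq, hC.isSymm_right.eq]
      _ = C * A := by rw [Matrix.mul_assoc C A (B * A), ← Matrix.mul_assoc A B A, hB.mul_mul_self]
  calc B = B * A * B := hB.self_mul_mul.symm
    _ = C * A * C := by rw [h2, Matrix.mul_assoc, h1, ← Matrix.mul_assoc]
    _ = C := hC.self_mul_mul

theorem exists_isMoorePenrose {n m : ℕ} (A : Matrix (Fin n) (Fin m) ℝ) :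
    ∃ B, IsMoorePenrose A B := by
  have hG : (Aᵀ * A).IsHermitian := by
    simpa [Matrix.conjTranspose_eq_transpose_of_trivial] using Matrix.isHermitian_conjTranspose_mul_self A
  obtain ⟨P, hPs, hGPG, hPGP, hcomm⟩ : ∃ P : Matrix (Fin m) (Fin m) ℝ,
      Pᵀ = P ∧ (Aᵀ * A) * P * (Aᵀ * A) = Aᵀ * A ∧ P * (Aᵀ * A) * P = P ∧
        P * (Aᵀ * A) = (Aᵀ * A) * P := by
    set U : Matrix (Fin m) (Fin m) ℝ := (hG.eigenvectorUnitary : Matrix (Fin m) (Fin m) ℝ)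
    set d := hG.eigenvalues
    have hU : Uᵀ * U = 1 := by
      have := Matrix.UnitaryGroup.star_mul_self hG.eigenvectorUnitary
      simpa [Matrix.star_eq_conjTranspose, Matrix.conjTranspose_eq_transpose_of_trivial] using this
    have hS : Aᵀ * A = U * Matrix.diagonal d * Uᵀ := by
      have := hG.spectral_theorem
      simpa [Unitary.conjStarAlgAut_apply, Matrix.star_eq_conjTranspose,
        Matrix.conjTranspose_eq_transpose_of_trivial, Function.comp_def] using this
    have key : ∀ a b : Fin m → ℝ, (U * Matrix.diagonal a * Uᵀ) * (U * Matrix.diagonal b * Uᵀ)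
        = U * Matrix.diagonal (fun i => a i * b i) * Uᵀ := by
      intro a b
      calc _ = U * Matrix.diagonal a * (Uᵀ * U) * Matrix.diagonal b * Uᵀ := by
            simp only [Matrix.mul_assoc]
        _ = _ := by rw [hU, Matrix.mul_one, Matrix.mul_assoc U, Matrix.diagonal_mul_diagonal]
    refine ⟨U * Matrix.diagonal (fun i => (d i)⁻¹) * Uᵀ, ?_, ?_, ?_, ?_⟩
    · simp [Matrix.transpose_mul, Matrix.mul_assoc]
    · rw [hS, key, key]; simp
    · rw [hS, key, key]; congr 3; ext i
      by_cases h : d i = 0 <;> simp [h]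
    · rw [hS, key, key]; simp [mul_comm]
  have hsymm : (P * (Aᵀ * A))ᵀ = P * (Aᵀ * A) := by
    rw [Matrix.transpose_mul, hPs, Matrix.transpose_mul, Matrix.transpose_transpose, hcomm]
  refine ⟨P * Aᵀ, ?_, ?_, ?_, ?_⟩
  · have h0 : A * (P * (Aᵀ * A) - 1) = 0 := by
      rw [← Matrix.conjTranspose_mul_self_eq_zero]
      rw [Matrix.conjTranspose_eq_transpose_of_trivial, Matrix.transpose_mul, Matrix.mul_assoc,
        ← Matrix.mul_assoc Aᵀ A, Matrix.mul_sub, ← Matrix.mul_assoc (Aᵀ * A) P, hGPG]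
      simp
    rw [Matrix.mul_sub, Matrix.mul_one, sub_eq_zero] at h0
    simpa [Matrix.mul_assoc] using h0
  · calc P * Aᵀ * A * (P * Aᵀ) = (P * (Aᵀ * A) * P) * Aᵀ := by simp only [Matrix.mul_assoc]
      _ = P * Aᵀ := by rw [hPGP]
  · simp [Matrix.IsSymm, Matrix.transpose_mul, hPs, Matrix.mul_assoc]
  · rw [Matrix.IsSymm, Matrix.mul_assoc, hsymm]

/-- The Moore-Penrose pseudo-inverse `A†`: the unique solution of the Penrose equations. -/
noncomputable def moorePenrose {n m : ℕ} (A : Matrix (Fin n) (Fin m) ℝ) :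
    Matrix (Fin m) (Fin n) ℝ :=
  (exists_isMoorePenrose A).choose

theorem isMoorePenrose_moorePenrose {n m : ℕ} (A : Matrix (Fin n) (Fin m) ℝ) :
    IsMoorePenrose A (moorePenrose A) :=
  (exists_isMoorePenrose A).choose_spec


/-!
Put `M = AᵀA + c` with `c > 0` and choose `δ` with `δ * tr M⁻¹ = 1`. Replacing `M` by `M - δ` and
then deleting a suitable row and column preserves `δ * tr M⁻¹ ≤ 1`: by Cauchy–Schwarz this holds on
average over the deleted index `i` when `i` has weight `((M - δ)⁻¹) i i`. After `m - k` such steps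
and one last shift, a principal `k × k` submatrix of `AᵀA + c - δ (m - k + 1)` is positive
semidefinite. Here `δ = c / (m - D)`, where `D` is the effective dimension of `A` at level `c`, and
Titu's inequality bounds `D` below in terms of `r` and the sum of the first `r` inverse squared
singular values. It remains to optimize `c`.
-/

section FunctionalCalculus

open scoped ComplexOrder

variable {𝕜 ι : Type*} [RCLike 𝕜] [Fintype ι] [DecidableEq ι] {M : Matrix ι ι 𝕜}

theorem continuousOn_spectrum_real (M : Matrix ι ι 𝕜) (f : ℝ → ℝ) :
    ContinuousOn f (spectrum ℝ M) :=
  Matrix.finite_real_spectrum.continuousOn f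

theorem trace_cfc (hM : M.IsHermitian) (f : ℝ → ℝ) :
    (cfc f M).trace = ∑ i, (f (hM.eigenvalues i) : 𝕜) := by
  rw [hM.cfc_eq, Matrix.IsHermitian.cfc, Unitary.conjStarAlgAut_apply, Matrix.trace_mul_cycle,
    Unitary.coe_star_mul_self, one_mul, Matrix.trace_diagonal]
  rfl

theorem posSemidef_cfc_iff (hM : M.IsHermitian) (f : ℝ → ℝ) :
    (cfc f M).PosSemidef ↔ ∀ i, 0 ≤ f (hM.eigenvalues i) := by
  rw [hM.cfc_eq, Matrix.IsHermitian.cfc, Unitary.conjStarAlgAut_apply,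
    Matrix.IsUnit.posSemidef_star_right_conjugate_iff Unitary.isUnit_coe,
    Matrix.posSemidef_diagonal_iff]
  simp

theorem posDef_cfc_iff (hM : M.IsHermitian) (f : ℝ → ℝ) :
    (cfc f M).PosDef ↔ ∀ i, 0 < f (hM.eigenvalues i) := by
  rw [hM.cfc_eq, Matrix.IsHermitian.cfc, Unitary.conjStarAlgAut_apply,
    Matrix.IsUnit.posDef_star_right_conjugate_iff Unitary.isUnit_coe, Matrix.posDef_diagonal_iff]
  simp

theorem cfc_sub_const_eq_sub_smul_one (hM : M.IsHermitian) (c : ℝ) :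
    cfc (fun x => x - c) M = M - c • 1 := by
  rw [cfc_sub (fun x => x) (fun _ => c) M, cfc_id' ℝ M, cfc_const c M,
    Algebra.algebraMap_eq_smul_one]

theorem cfc_inv_add_const_eq_inv (hM : M.IsHermitian) {c : ℝ}
    (hc : ∀ i, hM.eigenvalues i + c ≠ 0) :
    cfc (fun x => (x + c)⁻¹) M = (M + c • 1)⁻¹ := by
  have hspec : ∀ x ∈ spectrum ℝ M, x + c ≠ 0 := by
    rw [hM.spectrum_real_eq_range_eigenvalues]
    exact Set.forall_mem_range.mpr hc
  rw [cfc_inv (fun x => x + c) M hspec, cfc_add_const c _ M, cfc_id' ℝ M,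
    Algebra.algebraMap_eq_smul_one, Matrix.nonsing_inv_eq_ringInverse]

theorem cfc_inv_eq_inv (hM : M.IsHermitian) (hu : IsUnit M) :
    cfc (fun x : ℝ => x⁻¹) M = M⁻¹ := by
  rw [Matrix.nonsing_inv_eq_ringInverse]
  exact cfc_ringInverse_id M hu hM

end FunctionalCalculus

section Barrier

theorem mul_sq_sum_inv_le {ι : Type*} {s : Finset ι} {d : ι → ℝ} {δ : ℝ} (hd : ∀ i ∈ s, 0 < d i)
    (hδ : 0 ≤ δ) (h : δ * ∑ i ∈ s, (d i + δ)⁻¹ ≤ 1) :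
    δ * (∑ i ∈ s, (d i)⁻¹) ^ 2 ≤ ∑ i ∈ s, (d i)⁻¹ + δ * ∑ i ∈ s, (d i)⁻¹ * (d i)⁻¹ := by
  have hterm : ∀ i ∈ s, 0 ≤ (d i)⁻¹ + δ * ((d i)⁻¹ * (d i)⁻¹) := fun i hi => by
    have := hd i hi
    positivity
  have hcs := Finset.sum_sq_le_sum_mul_sum_of_sq_le_mul s hterm
    (fun i hi => inv_nonneg.mpr (add_nonneg (hd i hi).le hδ)) (r := fun i => (d i)⁻¹)
    fun i hi => le_of_eq <| by
      have := hd i hi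
      have : d i + δ ≠ 0 := by positivity
      field_simp
  rw [Finset.mul_sum s _ δ, ← Finset.sum_add_distrib]
  calc δ * (∑ i ∈ s, (d i)⁻¹) ^ 2
      ≤ δ * ((∑ i ∈ s, ((d i)⁻¹ + δ * ((d i)⁻¹ * (d i)⁻¹))) * ∑ i ∈ s, (d i + δ)⁻¹) := by gcongr
    _ = (∑ i ∈ s, ((d i)⁻¹ + δ * ((d i)⁻¹ * (d i)⁻¹))) * (δ * ∑ i ∈ s, (d i + δ)⁻¹) := by ring
    _ ≤ _ := mul_le_of_le_one_right (Finset.sum_nonneg hterm) h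

variable {ι : Type*} [Fintype ι]

theorem exists_mul_trace_sub_le_one [Nonempty ι] {X : Matrix ι ι ℝ} {δ : ℝ}
    (hX : ∀ i, 0 < X i i) (h : δ * X.trace ^ 2 ≤ X.trace + δ * (X * X).trace) :
    ∃ i, δ * (X.trace - (X * X) i i / X i i) ≤ 1 := by
  by_contra! hlt
  have hsum : ∑ i, X i i < ∑ i, δ * (X i i * X.trace - (X * X) i i) :=
    Finset.sum_lt_sum_of_nonempty Finset.univ_nonempty fun i _ => by
      calc X i i = X i i * 1 := (mul_one _).symm
        _ < X i i * (δ * (X.trace - (X * X) i i / X i i)) := by gcongr; exacts [hX i, hlt i]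
        _ = δ * (X i i * X.trace - (X * X) i i) := by
          have := (hX i).ne'
          field_simp
  rw [← Finset.mul_sum, Finset.sum_sub_distrib, ← Finset.sum_mul] at hsum
  change X.trace < δ * (X.trace * X.trace - (X * X).trace) at hsum
  linarith

theorem trace_inv_submatrix_succAbove {K : Type*} [Field K] {n : ℕ}
    {N : Matrix (Fin (n + 1)) (Fin (n + 1)) K} (hN : IsUnit N) {i : Fin (n + 1)}
    (hi : N⁻¹ i i ≠ 0) :
    (N.submatrix i.succAbove i.succAbove)⁻¹.trace =
      N⁻¹.trace - (N⁻¹ * N⁻¹) i i / N⁻¹ i i := by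
  set X := N⁻¹
  -- The inverse of the submatrix is the Schur complement of the entry `X i i` in `X`.
  let Y : Matrix (Fin (n + 1)) (Fin (n + 1)) K := .of fun a b => X a b - X a i * X i b / X i i
  have hYi : ∀ b, Y i b = 0 := fun b => by simp [Y, hi]
  have hNX : N * X = 1 := Matrix.mul_nonsing_inv _ ((Matrix.isUnit_iff_isUnit_det _).mp hN)
  have hNY : ∀ a b, (N * Y) a b =
      (1 : Matrix _ _ K) a b - (1 : Matrix _ _ K) a i * X i b / X i i := by
    intro a b
    simp_rw [← hNX, Matrix.mul_apply, Y, Matrix.of_apply, mul_sub, Finset.sum_sub_distrib,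
      Finset.sum_mul, Finset.sum_div, mul_assoc, mul_div_assoc]
  have hinv : (N.submatrix i.succAbove i.succAbove)⁻¹ = Y.submatrix i.succAbove i.succAbove := by
    refine Matrix.inv_eq_right_inv ?_
    ext a b
    have h := hNY (i.succAbove a) (i.succAbove b)
    rw [Matrix.mul_apply, Fin.sum_univ_succAbove _ i, hYi, mul_zero, zero_add,
      Matrix.one_apply_ne (i.succAbove_ne a), zero_mul, zero_div, sub_zero] at h
    rw [Matrix.mul_apply]
    simpa [Matrix.one_apply] using h
  calc (N.submatrix i.succAbove i.succAbove)⁻¹.trace = Y.trace := by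
        rw [hinv, Matrix.trace, Matrix.trace, Fin.sum_univ_succAbove _ i]
        simp [hYi]
    _ = X.trace - (X * X) i i / X i i := by
        simp [Y, Matrix.trace, Matrix.mul_apply, Finset.sum_div, mul_comm]

variable [DecidableEq ι] {M : Matrix ι ι ℝ} {δ : ℝ}

theorem trace_inv_eq_sum_inv_eigenvalues (hM : M.PosDef) :
    M⁻¹.trace = ∑ i, (hM.isHermitian.eigenvalues i)⁻¹ := by
  rw [← cfc_inv_eq_inv hM.isHermitian hM.isUnit, trace_cfc hM.isHermitian]
  rfl

theorem posSemidef_sub_smul_one_of_mul_trace_inv_le_one (hM : M.PosDef) (hδ : 0 ≤ δ)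
    (h : δ * M⁻¹.trace ≤ 1) :
    (M - δ • 1).PosSemidef := by
  rw [← cfc_sub_const_eq_sub_smul_one hM.isHermitian, posSemidef_cfc_iff hM.isHermitian]
  intro i
  have hpos := hM.eigenvalues_pos
  have hle : (hM.isHermitian.eigenvalues i)⁻¹ ≤ M⁻¹.trace := by
    rw [trace_inv_eq_sum_inv_eigenvalues hM]
    exact Finset.single_le_sum (f := fun j => (hM.isHermitian.eigenvalues j)⁻¹)
      (fun j _ => (inv_pos.mpr (hpos j)).le) (Finset.mem_univ i)
  rw [sub_nonneg, ← div_le_one₀ (hpos i), div_eq_mul_inv]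
  exact (mul_le_mul_of_nonneg_left hle hδ).trans h

theorem posDef_sub_smul_one_of_mul_trace_inv_le_one [Nontrivial ι] (hM : M.PosDef) (hδ : 0 < δ)
    (h : δ * M⁻¹.trace ≤ 1) :
    (M - δ • 1).PosDef := by
  rw [← cfc_sub_const_eq_sub_smul_one hM.isHermitian, posDef_cfc_iff hM.isHermitian]
  intro i
  have hpos := hM.eigenvalues_pos
  obtain ⟨j, hj⟩ := exists_ne i
  have hlt : (hM.isHermitian.eigenvalues i)⁻¹ < M⁻¹.trace := by
    rw [trace_inv_eq_sum_inv_eigenvalues hM]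
    exact Finset.single_lt_sum hj (Finset.mem_univ i) (Finset.mem_univ j)
      (inv_pos.mpr (hpos j)) fun l _ _ => (inv_pos.mpr (hpos l)).le
  rw [sub_pos, ← div_lt_one₀ (hpos i), div_eq_mul_inv]
  exact (mul_lt_mul_of_pos_left hlt hδ).trans_le h

theorem mul_sq_trace_inv_le {N : Matrix ι ι ℝ} (hN : N.PosDef) (hδ : 0 ≤ δ)
    (h : δ * (N + δ • 1)⁻¹.trace ≤ 1) :
    δ * N⁻¹.trace ^ 2 ≤ N⁻¹.trace + δ * (N⁻¹ * N⁻¹).trace := by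
  have hpos := hN.eigenvalues_pos
  have hcont := continuousOn_spectrum_real N
  rw [← cfc_inv_add_const_eq_inv hN.isHermitian fun i => (add_pos_of_pos_of_nonneg (hpos i) hδ).ne',
    trace_cfc hN.isHermitian] at h
  rw [← cfc_inv_eq_inv hN.isHermitian hN.isUnit, ← cfc_mul _ _ N (hcont _) (hcont _),
    trace_cfc hN.isHermitian, trace_cfc hN.isHermitian]
  exact mul_sq_sum_inv_le (fun i _ => hpos i) hδ h

theorem exists_posDef_submatrix_succAbove {n : ℕ} {M : Matrix (Fin (n + 1)) (Fin (n + 1)) ℝ}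
    (hn : n ≠ 0) (hM : M.PosDef) (hδ : 0 < δ) (h : δ * M⁻¹.trace ≤ 1) :
    ∃ i : Fin (n + 1), ((M - δ • 1).submatrix i.succAbove i.succAbove).PosDef ∧
      δ * ((M - δ • 1).submatrix i.succAbove i.succAbove)⁻¹.trace ≤ 1 := by
  have : NeZero n := ⟨hn⟩
  have hN := posDef_sub_smul_one_of_mul_trace_inv_le_one hM hδ h
  have hdiag : ∀ i, 0 < (M - δ • 1)⁻¹ i i := fun i => hN.inv.diag_pos
  obtain ⟨i, hi⟩ := exists_mul_trace_sub_le_one hdiag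
    (mul_sq_trace_inv_le hN hδ.le (by rwa [sub_add_cancel]))
  rw [← trace_inv_submatrix_succAbove hN.isUnit (hdiag i).ne'] at hi
  exact ⟨i, hN.submatrix Fin.succAbove_right_injective, hi⟩

theorem exists_embedding_posSemidef_submatrix {k d : ℕ} (hk : k ≠ 0) (hkd : k ≤ d) (hδ : 0 < δ)
    {M : Matrix (Fin d) (Fin d) ℝ} (hM : M.PosDef) (h : δ * M⁻¹.trace ≤ 1) :
    ∃ f : Fin k ↪ Fin d, ((M - (δ * (d - k + 1)) • 1).submatrix f f).PosSemidef := by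
  induction d, hkd using Nat.le_induction with
  | base => exact ⟨.refl _, by
    simpa [Function.Embedding.coe_refl] using
      posSemidef_sub_smul_one_of_mul_trace_inv_le_one hM hδ.le h⟩
  | succ d hkd ih =>
    obtain ⟨i, hi, hi'⟩ := exists_posDef_submatrix_succAbove (by lia) hM hδ h
    obtain ⟨f, hf⟩ := ih hi hi'
    refine ⟨f.trans i.succAboveEmb, ?_⟩
    convert! hf using 1
    ext a b
    simp only [Function.Embedding.coe_trans, Fin.coe_succAboveEmb, Matrix.submatrix_apply,
      Function.comp_apply, Matrix.sub_apply, Matrix.smul_apply, smul_eq_mul, Matrix.one_apply,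
      Fin.succAbove_right_inj]
    push_cast
    ring

end Barrier

section EuclideanLin

theorem finrank_range_toEuclideanLin {ι κ : Type*} [Finite ι] [Fintype κ] [DecidableEq κ]
    (A : Matrix ι κ ℝ) :
    Module.finrank ℝ (Matrix.toEuclideanLin A).range = A.rank := by
  cases nonempty_fintype ι
  rw [Matrix.toEuclideanLin, Matrix.toLpLin_eq_toLin]
  exact (Matrix.rank_eq_finrank_range_toLin A _ _).symm

variable {ι κ : Type*} [Fintype ι] (A : Matrix ι κ ℝ)

theorem posSemidef_transpose_mul_self [Finite κ] : (Aᵀ * A).PosSemidef := by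
  simpa only [Matrix.conjTranspose_eq_transpose_of_trivial] using
    Matrix.posSemidef_conjTranspose_mul_self A

variable [Fintype κ] [DecidableEq κ]

theorem norm_toEuclideanLin_sq (x : EuclideanSpace ℝ κ) :
    ‖Matrix.toEuclideanLin A x‖ ^ 2 = x.ofLp ⬝ᵥ (Aᵀ * A) *ᵥ x.ofLp := by
  rw [← Matrix.mulVec_mulVec, Matrix.dotProduct_mulVec, Matrix.vecMul_transpose,
    EuclideanSpace.norm_sq_eq, dotProduct]
  simp [Matrix.toLpLin_apply, sq]

theorem adjoint_comp_toEuclideanLin :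
    (Matrix.toEuclideanLin A).adjoint ∘ₗ Matrix.toEuclideanLin A =
      Matrix.toEuclideanLin (Aᵀ * A) := by
  classical
  rw [← Matrix.toEuclideanLin_conjTranspose_eq_adjoint,
    Matrix.conjTranspose_eq_transpose_of_trivial]
  ext x i
  simp [Matrix.toLpLin_apply]

theorem charpoly_adjoint_comp_toEuclideanLin :
    ((Matrix.toEuclideanLin A).adjoint ∘ₗ Matrix.toEuclideanLin A).charpoly =
      (Aᵀ * A).charpoly := by
  rw [adjoint_comp_toEuclideanLin, Matrix.toEuclideanLin, Matrix.toLpLin_eq_toLin,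
    Matrix.charpoly_toLin]

end EuclideanLin

section SingularValues

variable {n m : ℕ} (A : Matrix (Fin n) (Fin m) ℝ)

theorem roots_charpoly_transpose_mul_self :
    (Aᵀ * A).charpoly.roots = Finset.univ.val.map fun i : Fin m => sigma A i ^ 2 := by
  have hfin : Module.finrank ℝ (EuclideanSpace ℝ (Fin m)) = m := finrank_euclideanSpace_fin
  have hroots := (Matrix.toEuclideanLin A).isSymmetric_adjoint_comp_self
    |>.roots_charpoly_eq_eigenvalues hfin
  rw [charpoly_adjoint_comp_toEuclideanLin] at hroots
  simp only [sigma, (Matrix.toEuclideanLin A).sq_singularValues_fin hfin]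
  exact hroots

theorem trace_cfc_transpose_mul_self (F : ℝ → ℝ) :
    (cfc F (Aᵀ * A)).trace = ∑ i ∈ Finset.range m, F (sigma A i ^ 2) := by
  have hG := (posSemidef_transpose_mul_self A).isHermitian
  have hmap := congrArg (fun s => (s.map F).sum)
    (hG.roots_charpoly_eq_eigenvalues.symm.trans (roots_charpoly_transpose_mul_self A))
  rw [trace_cfc hG, Finset.sum_range]
  simpa [Multiset.map_map, Function.comp_def, Finset.sum] using hmap

variable {A}

theorem sigma_pos_iff {i : ℕ} : 0 < sigma A i ↔ i < A.rank := by
  rw [← finrank_range_toEuclideanLin]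
  exact LinearMap.singularValues_pos_iff_lt_finrank_range _

theorem sigma_eq_zero_iff {i : ℕ} : sigma A i = 0 ↔ A.rank ≤ i := by
  rw [← finrank_range_toEuclideanLin]
  exact LinearMap.singularValues_eq_zero_iff_le_finrank_range _

end SingularValues

section PseudoInverse

variable {n m : ℕ} {A : Matrix (Fin n) (Fin m) ℝ}

theorem frobenius_norm_sq_eq_trace {ι κ : Type*} [Fintype ι] [Fintype κ] (B : Matrix ι κ ℝ) :
    ‖B‖ ^ 2 = (B * Bᵀ).trace := by
  rw [Matrix.frobenius_norm_def, ← Real.sqrt_eq_rpow, Real.sq_sqrt (by positivity)]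
  simp [Matrix.trace, Matrix.mul_apply, sq]

theorem IsMoorePenrose.transpose_mul_mul {B : Matrix (Fin m) (Fin n) ℝ}
    (h : IsMoorePenrose A B) : Aᵀ * (A * B) = Aᵀ := by
  rw [← h.isSymm_left.eq, ← Matrix.transpose_mul, h.mul_mul_self]

theorem IsMoorePenrose.transpose_mul_self {B : Matrix (Fin m) (Fin n) ℝ}
    (h : IsMoorePenrose A B) : IsMoorePenrose (Aᵀ * A) (B * Bᵀ) := by
  have hright : Aᵀ * A * (B * Bᵀ) = B * A := by
    rw [← Matrix.mul_assoc, Matrix.mul_assoc Aᵀ, h.transpose_mul_mul, ← Matrix.transpose_mul,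
      h.isSymm_right.eq]
  have hleft : B * Bᵀ * (Aᵀ * A) = B * A := by
    simpa [Matrix.transpose_mul, h.isSymm_right.eq] using congrArg Matrix.transpose hright
  refine ⟨?_, ?_, hright ▸ h.isSymm_right, hleft ▸ h.isSymm_right⟩
  · rw [Matrix.mul_assoc, hleft, Matrix.mul_assoc, ← Matrix.mul_assoc A, h.mul_mul_self]
  · rw [hleft, ← Matrix.mul_assoc, h.self_mul_mul]

theorem isMoorePenrose_cfc_inv {G : Matrix (Fin n) (Fin n) ℝ} (hG : G.IsHermitian) :
    IsMoorePenrose G (cfc (fun x : ℝ => x⁻¹) G) := by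
  have hcont := continuousOn_spectrum_real G
  have hid : cfc (fun x : ℝ => x) G = G := cfc_id' ℝ G
  have hinv (x : ℝ) : x⁻¹ * x * x⁻¹ = x⁻¹ := by simpa using mul_inv_mul_cancel x⁻¹
  have hright : G * cfc (fun x : ℝ => x⁻¹) G = cfc (fun x : ℝ => x * x⁻¹) G := by
    rw [cfc_mul _ _ G (hcont _) (hcont _), hid]
  have hleft : cfc (fun x : ℝ => x⁻¹) G * G = cfc (fun x : ℝ => x⁻¹ * x) G := by
    rw [cfc_mul _ _ G (hcont _) (hcont _), hid]
  have hsymm (f : ℝ → ℝ) : (cfc f G).IsSymm := cfc_predicate f G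
  refine ⟨?_, ?_, hright ▸ hsymm _, hleft ▸ hsymm _⟩
  · nth_rewrite 3 [← hid]
    rw [hright, ← cfc_mul _ _ G (hcont _) (hcont _)]
    simp only [mul_inv_mul_cancel, hid]
  · rw [hleft, ← cfc_mul _ _ G (hcont _) (hcont _)]
    simp only [hinv]

theorem norm_moorePenrose_sq (A : Matrix (Fin n) (Fin m) ℝ) :
    ‖moorePenrose A‖ ^ 2 = ∑ i ∈ Finset.range A.rank, (sigma A i ^ 2)⁻¹ := by
  have hgram : moorePenrose A * (moorePenrose A)ᵀ = cfc (fun x : ℝ => x⁻¹) (Aᵀ * A) :=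
    (isMoorePenrose_moorePenrose A).transpose_mul_self.unique
      (isMoorePenrose_cfc_inv (posSemidef_transpose_mul_self A).isHermitian)
  rw [frobenius_norm_sq_eq_trace, hgram, trace_cfc_transpose_mul_self]
  refine (Finset.sum_subset (Finset.range_subset_range.mpr A.rank_le_width) fun i _ hi => ?_).symm
  rw [sigma_eq_zero_iff.mpr (by simpa using hi), zero_pow two_ne_zero, inv_zero]

end PseudoInverse

section ColumnSelection

variable {n m : ℕ}

theorem le_sigmaMin_sq_of_posSemidef {ι : Type*} [Fintype ι] [DecidableEq ι] [Nonempty ι]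
    {B : Matrix (Fin n) ι ℝ} {b : ℝ} (h : (Bᵀ * B - b • 1).PosSemidef) :
    b ≤ sigmaMin B ^ 2 := by
  obtain ⟨x, hx : ‖x‖ = 1, hmin⟩ := (isLeast_sigmaMin B).1
  have hxx : x.ofLp ⬝ᵥ x.ofLp = 1 := by
    simpa [hx, dotProduct, sq] using (EuclideanSpace.norm_sq_eq x).symm
  have hnonneg := h.dotProduct_mulVec_nonneg x.ofLp
  rw [star_trivial, Matrix.sub_mulVec, Matrix.smul_mulVec, Matrix.one_mulVec, dotProduct_sub,
    dotProduct_smul, hxx, smul_eq_mul, mul_one, ← norm_toEuclideanLin_sq, sub_nonneg] at hnonneg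
  rwa [← hmin]

theorem columnSubmatrix_transpose_mul_self (A : Matrix (Fin n) (Fin m) ℝ) (S : Finset (Fin m)) :
    (columnSubmatrix A S)ᵀ * columnSubmatrix A S = (Aᵀ * A).submatrix Subtype.val Subtype.val :=
  rfl

theorem exists_finset_le_sigmaMin_sq_of_embedding {A : Matrix (Fin n) (Fin m) ℝ} {k : ℕ}
    (hk : k ≠ 0) {b : ℝ} (f : Fin k ↪ Fin m)
    (h : ((Aᵀ * A - b • 1).submatrix f f).PosSemidef) :
    ∃ S : Finset (Fin m), S.card = k ∧ b ≤ sigmaMin (columnSubmatrix A S) ^ 2 := by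
  let S : Finset (Fin m) := Finset.univ.map f
  have hS : S.card = k := by simp [S]
  have : Nonempty S := (Finset.card_pos.mp (by lia)).to_subtype
  have hmem (x : S) : ∃ i, f i = x := by
    obtain ⟨i, -, hi⟩ := Finset.mem_map.mp x.2
    exact ⟨i, hi⟩
  choose g hg using hmem
  refine ⟨S, hS, le_sigmaMin_sq_of_posSemidef ?_⟩
  convert! h.submatrix g using 1
  ext x y
  simp only [columnSubmatrix_transpose_mul_self, Matrix.submatrix_apply, Matrix.sub_apply,
    Matrix.smul_apply, Matrix.one_apply, hg, Subtype.ext_iff]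

/-- The effective dimension `tr (AᵀA (AᵀA + c)⁻¹)` of `A` at the regularisation level `c`,
expressed through the singular values. -/
noncomputable def effectiveDim (A : Matrix (Fin n) (Fin m) ℝ) (c : ℝ) : ℝ :=
  ∑ i ∈ Finset.range m, sigma A i ^ 2 / (sigma A i ^ 2 + c)

variable {A : Matrix (Fin n) (Fin m) ℝ} {c : ℝ}

theorem effectiveDim_nonneg (hc : 0 ≤ c) : 0 ≤ effectiveDim A c :=
  Finset.sum_nonneg fun _ _ => by positivity

theorem posDef_transpose_mul_self_add_smul_one (hc : 0 < c) : (Aᵀ * A + c • 1).PosDef :=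
  (Matrix.PosDef.one.smul hc).posSemidef_add (posSemidef_transpose_mul_self A)

theorem mul_trace_inv_transpose_mul_self_add (hc : 0 < c) :
    c * (Aᵀ * A + c • 1)⁻¹.trace = m - effectiveDim A c := by
  have hG := posSemidef_transpose_mul_self A
  rw [← cfc_inv_add_const_eq_inv hG.isHermitian fun i =>
      (add_pos_of_nonneg_of_pos (hG.eigenvalues_nonneg i) hc).ne',
    trace_cfc_transpose_mul_self, Finset.mul_sum, eq_sub_iff_add_eq, effectiveDim,
    ← Finset.sum_add_distrib]
  have hterm (i : ℕ) : c * (sigma A i ^ 2 + c)⁻¹ + sigma A i ^ 2 / (sigma A i ^ 2 + c) = 1 := by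
    field_simp
    ring
  simp [hterm]

theorem exists_finset_mul_effectiveDim_sub_le_sigmaMin_sq {k : ℕ} (hk : k ≠ 0)
    (hkm : k ≤ m) (hc : 0 < c) :
    ∃ S : Finset (Fin m), S.card = k ∧
      c * (effectiveDim A c - (k - 1)) ≤ sigmaMin (columnSubmatrix A S) ^ 2 * m := by
  have hM := posDef_transpose_mul_self_add_smul_one (A := A) hc
  have : NeZero m := ⟨by lia⟩
  have htr := hM.inv.trace_pos
  have hgap : 0 < m - effectiveDim A c := by
    rw [← mul_trace_inv_transpose_mul_self_add hc]
    positivity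
  have hδ : c / (m - effectiveDim A c) * (Aᵀ * A + c • 1)⁻¹.trace = 1 := by
    rw [← mul_trace_inv_transpose_mul_self_add hc]
    field_simp
  obtain ⟨f, hf⟩ := exists_embedding_posSemidef_submatrix hk hkm (div_pos hc hgap) hM hδ.le
  rw [add_sub_right_comm, sub_add, ← sub_smul] at hf
  obtain ⟨S, hS, hle⟩ := exists_finset_le_sigmaMin_sq_of_embedding hk f hf
  refine ⟨S, hS, ?_⟩
  calc c * (effectiveDim A c - (k - 1))
      = (c / (m - effectiveDim A c) * (m - k + 1) - c) * (m - effectiveDim A c) := by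
        field_simp
        ring
    _ ≤ sigmaMin (columnSubmatrix A S) ^ 2 * (m - effectiveDim A c) := by gcongr
    _ ≤ sigmaMin (columnSubmatrix A S) ^ 2 * m := by
        gcongr
        exact sub_le_self _ (effectiveDim_nonneg hc.le)

end ColumnSelection

section Optimization

theorem card_sq_div_le_sum_div_add {ι : Type*} {s : Finset ι} {x : ι → ℝ} {c : ℝ}
    (hx : ∀ i ∈ s, 0 < x i) (hc : 0 ≤ c) :
    (s.card : ℝ) ^ 2 / (s.card + c * ∑ i ∈ s, (x i)⁻¹) ≤ ∑ i ∈ s, x i / (x i + c) := by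
  have hTitu := Finset.sq_sum_div_le_sum_sq_div s (fun _ => (1 : ℝ))
    (g := fun i => 1 + c * (x i)⁻¹) fun i hi => by
      have := hx i hi
      positivity
  rw [Finset.sum_add_distrib, ← Finset.mul_sum, Finset.sum_const, nsmul_one] at hTitu
  refine hTitu.trans_eq (Finset.sum_congr rfl fun i hi => ?_)
  have := hx i hi
  field_simp

theorem sq_div_le_effectiveDim {n m r : ℕ} {A : Matrix (Fin n) (Fin m) ℝ} (hr : r ≤ A.rank)
    {c : ℝ} (hc : 0 ≤ c) :
    (r : ℝ) ^ 2 / (r + c * ∑ i ∈ Finset.range r, (sigma A i ^ 2)⁻¹) ≤ effectiveDim A c := by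
  have hpos : ∀ i ∈ Finset.range r, 0 < sigma A i ^ 2 := fun i hi =>
    pow_pos (sigma_pos_iff.mpr ((Finset.mem_range.mp hi).trans_le hr)) 2
  calc (r : ℝ) ^ 2 / (r + c * ∑ i ∈ Finset.range r, (sigma A i ^ 2)⁻¹)
      ≤ ∑ i ∈ Finset.range r, sigma A i ^ 2 / (sigma A i ^ 2 + c) := by
        simpa using card_sq_div_le_sum_div_add hpos hc
    _ ≤ effectiveDim A c :=
        Finset.sum_le_sum_of_subset_of_nonneg
          (Finset.range_subset_range.mpr (hr.trans A.rank_le_width)) fun _ _ _ => by positivity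

theorem sq_sub_mul_div_le_of_forall_pos {a b N Y : ℝ} (hb : 0 ≤ b) (hab : b < a) (hN : 0 < N)
    (h : ∀ c > 0, c * ((a ^ 2) ^ 2 / (a ^ 2 + c * N) - b ^ 2) ≤ Y) :
    (a - b) ^ 2 * (a ^ 2 / N) ≤ Y := by
  -- The optimal `c` is the one below for `t = b`; it degenerates when `b = 0`, hence the limit.
  have hlt : ∀ t ∈ Set.Ioo b a, (a - t) ^ 2 * (a ^ 2 / N) ≤ Y := by
    rintro t ⟨hbt, hta⟩
    have ht : 0 < t := hb.trans_lt hbt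
    have ha : 0 < a := ht.trans hta
    have : 0 < a - t := sub_pos.mpr hta
    have hc : 0 < (a - t) / t * (a ^ 2 / N) := by positivity
    have hdim : (a ^ 2) ^ 2 / (a ^ 2 + (a - t) / t * (a ^ 2 / N) * N) = a * t := by
      field_simp
      ring
    calc (a - t) ^ 2 * (a ^ 2 / N)
        = (a - t) / t * (a ^ 2 / N) * (a * t - t ^ 2) := by field_simp
      _ ≤ (a - t) / t * (a ^ 2 / N) * (a * t - b ^ 2) := by gcongr
      _ ≤ Y := hdim ▸ h _ hc
  have hlim : Filter.Tendsto (fun t => (a - t) ^ 2 * (a ^ 2 / N)) (nhdsWithin b (Set.Ioi b))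
      (nhds ((a - b) ^ 2 * (a ^ 2 / N))) :=
    Continuous.tendsto' (by fun_prop) _ _ rfl |>.mono_left nhdsWithin_le_nhds
  exact le_of_tendsto hlim (Filter.mem_of_superset (Ioo_mem_nhdsGT hab) hlt)

end Optimization

section RestrictedInvertibility

theorem exists_finset_card_eq_forall_le {α β : Type*} [Fintype α] [LinearOrder β]
    (F : Finset α → β) {k : ℕ} (hk : k ≤ Fintype.card α) :
    ∃ S : Finset α, S.card = k ∧ ∀ T : Finset α, T.card = k → F T ≤ F S := by
  obtain ⟨S, hS, hmax⟩ := Finset.exists_max_image (Finset.powersetCard k Finset.univ) F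
    (Finset.powersetCard_nonempty.mpr hk)
  exact ⟨S, Finset.mem_powersetCard_univ.mp hS, fun T hT =>
    hmax T (Finset.mem_powersetCard_univ.mpr hT)⟩

theorem exists_finset_sq_sub_mul_le_sigmaMin_sq {n m k r : ℕ} (A : Matrix (Fin n) (Fin m) ℝ)
    (hk : 1 ≤ k) (hkr : k ≤ r) (hr : r ≤ A.rank) :
    ∃ S : Finset (Fin m), S.card = k ∧
      (√(r : ℝ) - √((k : ℝ) - 1)) ^ 2 / (m : ℝ) *
        ((r : ℝ) / ∑ i ∈ Finset.range r, (sigma A i ^ 2)⁻¹) ≤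
          sigmaMin (columnSubmatrix A S) ^ 2 := by
  have hkm : k ≤ m := hkr.trans (hr.trans A.rank_le_width)
  have hm : (0 : ℝ) < m := by exact_mod_cast hk.trans hkm
  have hk' : (0 : ℝ) ≤ k - 1 := sub_nonneg.mpr (by exact_mod_cast hk)
  have hkr' : (k : ℝ) - 1 < r := by
    rw [sub_lt_iff_lt_add]
    exact_mod_cast Nat.lt_succ_of_le hkr
  have hN : 0 < ∑ i ∈ Finset.range r, (sigma A i ^ 2)⁻¹ :=
    Finset.sum_pos (fun i hi => inv_pos.mpr <| pow_pos
      (sigma_pos_iff.mpr ((Finset.mem_range.mp hi).trans_le hr)) 2)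
      (Finset.nonempty_range_iff.mpr (by lia))
  obtain ⟨S, hS, hmax⟩ := exists_finset_card_eq_forall_le
    (fun T => sigmaMin (columnSubmatrix A T) ^ 2) (hkm.trans_eq (Fintype.card_fin m).symm)
  refine ⟨S, hS, ?_⟩
  have hbound : ∀ c > 0, c * ((√(r : ℝ) ^ 2) ^ 2 /
      (√(r : ℝ) ^ 2 + c * ∑ i ∈ Finset.range r, (sigma A i ^ 2)⁻¹) - √((k : ℝ) - 1) ^ 2) ≤
        sigmaMin (columnSubmatrix A S) ^ 2 * m := fun c hc => by
    obtain ⟨T, hT, hle⟩ :=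
      exists_finset_mul_effectiveDim_sub_le_sigmaMin_sq (A := A) (by lia) hkm hc
    rw [Real.sq_sqrt r.cast_nonneg, Real.sq_sqrt hk']
    calc _ ≤ c * (effectiveDim A c - (k - 1)) := by gcongr; exact sq_div_le_effectiveDim hr hc.le
      _ ≤ sigmaMin (columnSubmatrix A T) ^ 2 * m := hle
      _ ≤ sigmaMin (columnSubmatrix A S) ^ 2 * m := by gcongr ?_ * _; exact hmax T hT
  have hmain := sq_sub_mul_div_le_of_forall_pos (Real.sqrt_nonneg _)
    (Real.sqrt_lt_sqrt hk' hkr') hN hbound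
  rwa [Real.sq_sqrt r.cast_nonneg, ← div_le_iff₀ hm, ← div_mul_eq_mul_div] at hmain

end RestrictedInvertibility

theorem corollary1p2 (n m : ℕ) (A : Matrix (Fin n) (Fin m) ℝ) (k r : ℕ)
    (hk : 1 ≤ k) (hkr : k ≤ r) (hr : r ≤ A.rank) :
    ∃ S : Finset (Fin m), S.card = k ∧
      (√(r : ℝ) - √((k : ℝ) - 1)) ^ 2 / (m : ℝ)
          * ((r : ℝ) / ∑ i ∈ Finset.range r, (sigma A i ^ 2)⁻¹)
        ≤ sigmaMin (columnSubmatrix A S) ^ 2 ∧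
      (r = A.rank →
        (√(A.rank : ℝ) - √((k : ℝ) - 1)) ^ 2 / (m : ℝ)
            * ((A.rank : ℝ) / ‖moorePenrose A‖ ^ 2)
          ≤ sigmaMin (columnSubmatrix A S) ^ 2) := by
  obtain ⟨S, hS, hbound⟩ := exists_finset_sq_sub_mul_le_sigmaMin_sq A hk hkr hr
  refine ⟨S, hS, hbound, ?_⟩
  rintro rfl
  rwa [norm_moorePenrose_sq]
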